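/- Setting. A logic program $P$ is a finite list of clauses $p(\bar t)\leftarrow b_1,\dots,b_m$, each $b_i$ being an atom or a unification $s=t$ (normalised clauses, with head $p(\bar x)$, are included). $P$ terminates for a goal if there is no infinite derivation from it with the leftmost selection rule and most general unifiers. Fix a semi-linear norm $\|f(t_1,\dots,t_n)\|=c_f+\sum_{i\in A_f}\|t_i\|$, $c_f\in\mathbb N$, $A_f\subseteq\{1,\dots,n\}$, variables having norm $0$ (for example term-size, where the instantiation notion below is groundness). A term is rigid if its norm is invariant under substitution; $\mathrm{rel}(t)$ is the set of variables contributing to the symbolic size of $t$. Loops. An abstract binary clause $p(\bar x)\leftarrow\pi,q(\bar y)$ has for $\pi$ a conjunction of linear constraints on the sizes $\bar x,\bar y\in\mathbb N$. Let $[\![P]\!]^{bin}_{size}$ be a result of the bottom-up size analysis of $P$, that is, together with a set of abstract answers $p(\bar x)\leftarrow\sigma$, any post-fixpoint of the abstract operator: up to weakening of the constraints, it contains the abstract answer that each clause yields from answers for its body, the abstract call from each clause head to each body atom whose predecessors have answers, and the composition of each such call with each abstract binary clause for the called predicate. A set $I$ of arguments is decreasing for $\beta=p(\bar x)\leftarrow\pi,p(\bar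 y)$ if there are real coefficients $a_i\ge 0$ with $\pi\models\sum_{i\in I}a_ix_i>\sum_{i\in I}a_iy_i$; $\mathcal D(\beta)$ is the set of all of these. A procedure $\mathsf{INF}$ is sound if $\mathsf{INF}(\beta)\subseteq\mathcal D(\beta)$ for all $\beta$. Inference. $\mathsf{Pos}$ is the set of positive Boolean functions (true when all variables are true) together with $\mathit{false}$, ordered by entailment. Put $\mu(\beta)=\bigvee_{I\in\mathsf{INF}(\beta)}\bigwedge_{x\in I}x$ and $\mu(p(\bar x))=\bigwedge_\beta\mu(\beta)$, over all $\beta=p(\bar x)\leftarrow\pi,p(\bar y)$ in $[\![P]\!]^{bin}_{size}$. Let $\psi_q(\bar x)$ be the success patterns: the least fixed point of the bottom-up instantiation analysis of $P$ over $\mathsf{Pos}$, where a unification $s=t$ is described by $\bigwedge\mathrm{rel}(s)\leftrightarrow\bigwedge\mathrm{rel}(t)$. Backwards analysis yields the greatest fixed point $(\varphi_p)_p$ over $\mathsf{Pos}$ of the operator that replaces $\varphi_p$ by its conjunction with $\forall_{\neg\bar x}\,(\mu(p(\bar x))\wedge e_1)$ for all clauses of $P$ for $p$. Here the clause is read as $p(\bar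 x)\leftarrow \bar x=\bar t,b_1,\dots,b_m$, whose body literals we number $1,\dots,k$; $e_{k+1}=\mathit{true}$ and $e_i=\varphi_i\wedge(\psi_i\rightarrow e_{i+1})$, with $\varphi_i,\psi_i$ the current precondition and the success pattern of the $i$-th literal ($\varphi_i=\mathit{true}$ for a unification); $\rightarrow$ is the pseudo-complement of $\mathsf{Pos}$, and the projection $\forall_{\neg\bar x}\sigma$ is the largest element of $\mathsf{Pos}$ on $\bar x$ that entails the universal quantification of $\sigma$ over all variables other than $\bar x$. A mode $p(m_1,\dots,m_n)$, $m_i\in\{\mathbf b,\mathbf f\}$, is inferred as terminating if $\bigwedge\{x_i\mid m_i=\mathbf b\}$ entails $\varphi_p$. Theorem. Let $\mathsf{INF}$ be a sound procedure, $P$ a logic program and $p(\bar m)$ a mode inferred as terminating. Then $P$ terminates for $p(\bar m)$: it terminates for every query $p(t_1,\dots,t_n)$ such that $t_i$ is rigid whenever $m_i=\mathbf b$. -/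

import Mathlib

universe u v

namespace LogicProgram

/-! Logic programs over a first-order language `L`: the function symbols of `L` build the terms,
the relation symbols of `L` are the predicates, and the variables are the natural numbers. -/

/-- A body literal: an atom `p(s₁,…,sₙ)` or a unification operation `s = t`. -/
inductive Lit (L : FirstOrder.Language.{u, v}) : Type (max u v)
  | atom {n : ℕ} (p : L.Relations n) (s : Fin n → L.Term ℕ) : Lit L
  | eq (s t : L.Term ℕ) : Lit L

/-- A clause `p(t₁,…,tₙ) ← b₁,…,bₘ`. Normalised clauses are those whose head arguments are
distinct variables. -/
structure Clause (L : FirstOrder.Language.{u, v}) : Type (max u v) where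
  arity : ℕ
  pred : L.Relations arity
  head : Fin arity → L.Term ℕ
  body : List (Lit L)

/-- A logic program is a finite list of clauses. -/
abbrev Program (L : FirstOrder.Language.{u, v}) := List (Clause L)

section Operational

variable {L : FirstOrder.Language.{u, v}}

/-- Substitutions. -/
abbrev Subst (L : FirstOrder.Language.{u, v}) := ℕ → L.Term ℕ

def Lit.subst (θ : Subst L) : Lit L → Lit L
  | .atom p s => .atom p (fun k => (s k).subst θ)
  | .eq s t => .eq (s.subst θ) (t.subst θ)

/-- The variables of a literal. -/
def Lit.vars : Lit L → Set ℕ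
  | .atom _ s => {x | ∃ k, x ∈ (s k).varFinset}
  | .eq s t => {x | x ∈ s.varFinset ∨ x ∈ t.varFinset}

/-- The variables of a goal. -/
def goalVars (G : List (Lit L)) : Set ℕ := {x | ∃ b ∈ G, x ∈ b.vars}

/-- The renaming `ρ` as a substitution. -/
def renameSubst (ρ : Equiv.Perm ℕ) : Subst L := fun x => FirstOrder.Language.Term.var (ρ x)

/-- The variant of a clause under a renameSubst. -/
def Clause.rename (ρ : Equiv.Perm ℕ) (C : Clause L) : Clause L where
  arity := C.arity
  pred := C.pred
  head := fun k => (C.head k).subst (renameSubst ρ)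
  body := C.body.map (Lit.subst (renameSubst ρ))

/-- The variables of a clause. -/
def Clause.vars (C : Clause L) : Set ℕ := (Lit.atom C.pred C.head).vars ∪ goalVars C.body

/-- `θ` unifies all the equations in `E`. -/
def IsUnifier (θ : Subst L) (E : Set (L.Term ℕ × L.Term ℕ)) : Prop :=
  ∀ e ∈ E, e.1.subst θ = e.2.subst θ

/-- `θ` is a most general unifier of `E`. -/
def IsMGU (θ : Subst L) (E : Set (L.Term ℕ × L.Term ℕ)) : Prop :=
  IsUnifier θ E ∧ ∀ η : Subst L, IsUnifier η E → ∃ δ : Subst L, ∀ x, η x = (θ x).subst δ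

/-- One derivation step with the leftmost selection rule: the first literal of the goal is
resolved with a variant of a program clause which is apart from the goal, or, if it is a
unification, is solved. -/
inductive Step (P : Program L) : List (Lit L) → List (Lit L) → Prop
  | resolve (C : Clause L) (hC : C ∈ P) (ρ : Equiv.Perm ℕ) (s : Fin C.arity → L.Term ℕ)
      (R : List (Lit L)) (θ : Subst L)
      (apart : Disjoint (C.rename ρ).vars (goalVars (Lit.atom C.pred s :: R)))
      (hθ : IsMGU θ (Set.range fun k : Fin C.arity => (s k, (C.rename ρ).head k))) :
      Step P (Lit.atom C.pred s :: R) (((C.rename ρ).body ++ R).map (Lit.subst θ))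
  | unify (s t : L.Term ℕ) (R : List (Lit L)) (θ : Subst L) (hθ : IsMGU θ {(s, t)}) :
      Step P (Lit.eq s t :: R) (R.map (Lit.subst θ))

/-- Universal termination: there is no infinite leftmost derivation from `G`. -/
def Terminates (P : Program L) (G : List (Lit L)) : Prop :=
  ¬ ∃ g : ℕ → List (Lit L), g 0 = G ∧ ∀ i, Step P (g i) (g (i + 1))

end Operational

section Norms

/-- A (semi-linear) norm on terms: `‖f(t₁,…,tₙ)‖ = c_f + ∑_{i ∈ A_f} ‖tᵢ‖`. -/
structure TermNorm (L : FirstOrder.Language.{u, v}) where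
  const : ∀ {n : ℕ}, L.Functions n → ℕ
  args : ∀ {n : ℕ}, L.Functions n → Finset (Fin n)

/-- The term-size norm: `‖f(t₁,…,tₙ)‖ = n + ∑ᵢ ‖tᵢ‖`. -/
def TermNorm.termSize (L : FirstOrder.Language.{u, v}) : TermNorm L where
  const := fun {n} _ => n
  args := fun _ => Finset.univ

variable {L : FirstOrder.Language.{u, v}} (N : TermNorm L)

/-- The symbolic size of a term: a linear expression in the sizes `w` of its variables. -/
def TermNorm.size (w : ℕ → ℕ) : L.Term ℕ → ℕ
  | .var x => w x
  | .func f ts => N.const f + ∑ i ∈ N.args f, TermNorm.size w (ts i)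

/-- The norm of a term; variables have norm `0`. -/
def TermNorm.norm (t : L.Term ℕ) : ℕ := N.size (fun _ => 0) t

/-- A term is rigid if its norm does not change under instantiation. -/
def TermNorm.Rigid (t : L.Term ℕ) : Prop := ∀ θ : Subst L, N.norm (t.subst θ) = N.norm t

/-- The variables that are relevant for the norm of a term, i.e. those which occur in its symbolic
size. For the term-size norm these are all the variables of the term. -/
def TermNorm.rel : L.Term ℕ → Set ℕ
  | .var x => {x}
  | .func f ts => {x | ∃ i ∈ N.args f, x ∈ TermNorm.rel (ts i)}

end Norms

section SizeRelations

inductive Comparison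
  | le
  | lt
  | eq

/-- A linear constraint `∑ᵢ cᵢ xᵢ + d ⋈ 0` with `⋈` one of `≤`, `<`, `=`. -/
structure LinConstr (V : Type) where
  coeff : V → ℚ
  const : ℚ
  cmp : Comparison

def LinConstr.Holds {V : Type} [Fintype V] (c : LinConstr V) (x : V → ℕ) : Prop :=
  match c.cmp with
  | .le => ∑ i, c.coeff i * (x i : ℚ) + c.const ≤ 0
  | .lt => ∑ i, c.coeff i * (x i : ℚ) + c.const < 0
  | .eq => ∑ i, c.coeff i * (x i : ℚ) + c.const = 0

/-- A size relation: a conjunction of linear constraints on sizes. -/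
abbrev SizeRel (V : Type) := List (LinConstr V)

def SizeRel.Holds {V : Type} [Fintype V] (π : SizeRel V) (x : V → ℕ) : Prop :=
  ∀ c ∈ π, c.Holds x

/-- Sets of abstract answers `p(x̄) ← σ`. -/
abbrev SizeAnswers (L : FirstOrder.Language.{u, v}) :=
  (n : ℕ) → L.Relations n → Set (SizeRel (Fin n))

/-- Sets of abstract binary clauses `p(x̄) ← π, q(ȳ)`. The relation `π` has the variables `x̄`
(left summand) and `ȳ` (right summand). -/
abbrev SizeBin (L : FirstOrder.Language.{u, v}) :=
  (m : ℕ) → L.Relations m → (n : ℕ) → L.Relations n → Set (SizeRel (Fin m ⊕ Fin n))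

variable {L : FirstOrder.Language.{u, v}} (N : TermNorm L)

/-- The size abstraction of a body literal, with answers from `S`, at the sizes `w` of the clause
variables. -/
def Lit.SizeHolds (S : SizeAnswers L) (w : ℕ → ℕ) : Lit L → Prop
  | .atom (n := n) p s => ∃ σ ∈ S n p, SizeRel.Holds σ (fun k => N.size w (s k))
  | .eq s t => N.size w s = N.size w t

/-- `S` (abstract answers) and `B` (abstract binary clauses) are the result of a size analysis of
`P`: a post-fixpoint of the bottom-up abstract semantics of binary clauses over the domain of size
relations. It contains, up to weakening (widening), all abstract answers, all abstract calls
from a head to a body atom whose predecessors in the body have succeeded, and all compositions of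
such a call with an abstract binary clause. -/
structure IsSizeAnalysis (P : Program L) (S : SizeAnswers L) (B : SizeBin L) : Prop where
  answer : ∀ C ∈ P, ∀ w : ℕ → ℕ, (∀ b ∈ C.body, b.SizeHolds N S w) →
    ∃ σ ∈ S C.arity C.pred, SizeRel.Holds σ (fun k => N.size w (C.head k))
  call : ∀ C ∈ P, ∀ w : ℕ → ℕ, ∀ (before after : List (Lit L)) (n : ℕ) (q : L.Relations n)
    (s : Fin n → L.Term ℕ), C.body = before ++ Lit.atom q s :: after →
    (∀ b ∈ before, b.SizeHolds N S w) →
    ∃ π ∈ B C.arity C.pred n q,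
      SizeRel.Holds π (Sum.elim (fun k => N.size w (C.head k)) (fun k => N.size w (s k)))
  comp : ∀ C ∈ P, ∀ w : ℕ → ℕ, ∀ (before after : List (Lit L)) (n : ℕ) (q : L.Relations n)
    (s : Fin n → L.Term ℕ), C.body = before ++ Lit.atom q s :: after →
    (∀ b ∈ before, b.SizeHolds N S w) →
    ∀ (k : ℕ) (r : L.Relations k) (z : Fin k → ℕ), ∀ π' ∈ B n q k r,
      SizeRel.Holds π' (Sum.elim (fun k => N.size w (s k)) z) →
      ∃ π ∈ B C.arity C.pred k r,
        SizeRel.Holds π (Sum.elim (fun k => N.size w (C.head k)) z)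

/-- The set `I` of argument positions is decreasing for `p(x̄) ← π, p(ȳ)`: with some non-negative
coefficients, `π` entails `∑_{i ∈ I} aᵢ xᵢ > ∑_{i ∈ I} aᵢ yᵢ`. -/
def IsDecreasing {n : ℕ} (π : SizeRel (Fin n ⊕ Fin n)) (I : Finset (Fin n)) : Prop :=
  ∃ a : Fin n → ℝ, (∀ i, 0 ≤ a i) ∧ ∀ x y : Fin n → ℕ, SizeRel.Holds π (Sum.elim x y) →
    ∑ i ∈ I, a i * (y i : ℝ) < ∑ i ∈ I, a i * (x i : ℝ)

/-- A procedure which maps each abstract binary clause `p(x̄) ← π, p(ȳ)` to sets of arguments. -/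
abbrev InfProc (L : FirstOrder.Language.{u, v}) :=
  (n : ℕ) → L.Relations n → SizeRel (Fin n ⊕ Fin n) → Set (Finset (Fin n))

/-- Soundness: only decreasing sets of arguments are reported. -/
def InfProc.Sound (INF : InfProc L) : Prop :=
  ∀ (n : ℕ) (p : L.Relations n) (π : SizeRel (Fin n ⊕ Fin n)),
    ∀ I ∈ INF n p π, IsDecreasing π I

end SizeRelations

section Pos

/-! Boolean functions on a set `V` of variables are given by their sets of models, a model being
the set of the variables that are true in it. Entailment is inclusion. -/

/-- The domain `Pos`: the positive Boolean functions, augmented with `false`. -/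
def IsPos {V : Type} (f : Set (Set V)) : Prop := f = ∅ ∨ Set.univ ∈ f

/-- The largest element of `Pos` which entails `f`. -/
def posPart {V : Type} (f : Set (Set V)) : Set (Set V) := ⋃₀ {σ | IsPos σ ∧ σ ⊆ f}

/-- The pseudo-complement of `ψ` with respect to `e` in `Pos`: the largest `σ` in `Pos` such that
`σ ∧ ψ` entails `e`. -/
def posImp {V : Type} (ψ e : Set (Set V)) : Set (Set V) := posPart {M | M ∈ ψ → M ∈ e}

/-- Assignments of a Boolean function of the arguments to each predicate. -/
abbrev BoolEnv (L : FirstOrder.Language.{u, v}) :=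
  (n : ℕ) → L.Relations n → Set (Set (Fin n))

theorem posPart_mono {V : Type} {f g : Set (Set V)} (h : f ⊆ g) : posPart f ⊆ posPart g :=
  Set.sUnion_subset_sUnion fun _ hσ => ⟨hσ.1, hσ.2.trans h⟩

variable {L : FirstOrder.Language.{u, v}} (N : TermNorm L)

/-- The argument positions of `s̄` which are instantiated in the model `M` of the instantiation of
the clause variables. -/
def instArgs {n : ℕ} (s : Fin n → L.Term ℕ) (M : Set ℕ) : Set (Fin n) :=
  {k | N.rel (s k) ⊆ M}

/-- The success of a body literal as a Boolean function of the clause variables: `Ψ_q(s̄)` for an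
atom `q(s̄)` and `⋀ rel(s) ↔ ⋀ rel(t)`, over the relevant variables, for a unification `s = t`. -/
def Lit.success (Ψ : BoolEnv L) : Lit L → Set (Set ℕ)
  | .atom (n := n) p s => {M | instArgs N s M ∈ Ψ n p}
  | .eq s t => {M | N.rel s ⊆ M ↔ N.rel t ⊆ M}

/-- The precondition of a body literal: `Φ_q(s̄)` for an atom `q(s̄)` and `true` for a
unification. -/
def Lit.pre (Φ : BoolEnv L) : Lit L → Set (Set ℕ)
  | .atom (n := n) p s => {M | instArgs N s M ∈ Φ n p}
  | .eq _ _ => Set.univ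

theorem Lit.success_mono {Ψ Ψ' : BoolEnv L} (h : Ψ ≤ Ψ') :
    ∀ b : Lit L, b.success N Ψ ⊆ b.success N Ψ'
  | .atom (n := n) p _ => fun _ hM => h n p hM
  | .eq _ _ => subset_rfl

theorem Lit.pre_mono {Φ Φ' : BoolEnv L} (h : Φ ≤ Φ') :
    ∀ b : Lit L, b.pre N Φ ⊆ b.pre N Φ'
  | .atom (n := n) p _ => fun _ hM => h n p hM
  | .eq _ _ => subset_rfl

/-- The bottom-up operator of the instantiation (groundness) analysis: the disjunction over the
clauses for `p` of the conjunctions of head and body, projected existentially on the arguments. -/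
def successOp (P : Program L) : BoolEnv L →o BoolEnv L where
  toFun Ψ := fun n p => {A | ∃ (t : Fin n → L.Term ℕ) (body : List (Lit L)),
    (⟨n, p, t, body⟩ : Clause L) ∈ P ∧
      ∃ M : Set ℕ, instArgs N t M = A ∧ ∀ b ∈ body, M ∈ b.success N Ψ}
  monotone' := by
    rintro Ψ Ψ' h n p A ⟨t, body, hC, M, hA, hM⟩
    exact ⟨t, body, hC, M, hA, fun b hb => Lit.success_mono N h b (hM b hb)⟩

/-- The approximation over `Pos` of the success set of `P`. -/
def successPatterns (P : Program L) : BoolEnv L := OrderHom.lfp (successOp N P)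

/-- The condition before a sequence of body literals, computed from right to left by
`e = φ ∧ (ψ → e')`, starting from `true`. -/
def bodyCond (Ψ Φ : BoolEnv L) : List (Lit L) → Set (Set ℕ)
  | [] => Set.univ
  | b :: bs => b.pre N Φ ∩ posImp (b.success N Ψ) (bodyCond Ψ Φ bs)

theorem bodyCond_mono (Ψ : BoolEnv L) {Φ Φ' : BoolEnv L} (h : Φ ≤ Φ') :
    ∀ bs : List (Lit L), bodyCond N Ψ Φ bs ⊆ bodyCond N Ψ Φ' bs
  | [] => subset_rfl
  | b :: bs => Set.inter_subset_inter (Lit.pre_mono N h b)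
      (posPart_mono fun _ hM hψ => bodyCond_mono Ψ h bs (hM hψ))

/-- One clause `p(t̄) ← μ ⋄ body`, read as `p(x̄) ← μ ⋄ x̄ = t̄, body`: the condition before the body
is conjoined with the assertion and projected universally on the arguments. -/
def clauseCond (μ Ψ Φ : BoolEnv L) {n : ℕ} (p : L.Relations n) (t : Fin n → L.Term ℕ)
    (body : List (Lit L)) : Set (Set (Fin n)) :=
  posPart {A | A ∈ μ n p ∧ ∀ M : Set ℕ, instArgs N t M = A → M ∈ bodyCond N Ψ Φ body}

/-- The operator of backwards analysis for `P` with assertions `μ` and success patterns `Ψ`. -/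
def backwardsOp (P : Program L) (μ Ψ : BoolEnv L) : BoolEnv L →o BoolEnv L where
  toFun Φ := fun n p => {A | A ∈ Φ n p ∧ ∀ (t : Fin n → L.Term ℕ) (body : List (Lit L)),
    (⟨n, p, t, body⟩ : Clause L) ∈ P → A ∈ clauseCond N μ Ψ Φ p t body}
  monotone' := by
    rintro Φ Φ' h n p A ⟨hA, hc⟩
    refine ⟨h n p hA, fun t body hC => posPart_mono ?_ (hc t body hC)⟩
    exact fun A' hA' => ⟨hA'.1, fun M hM => bodyCond_mono N Ψ h body (hA'.2 M hM)⟩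

/-- The result of backwards analysis: the greatest fixed point, reached from `true`. -/
def backwards (P : Program L) (μ Ψ : BoolEnv L) : BoolEnv L :=
  OrderHom.gfp (backwardsOp N P μ Ψ)

end Pos

section Inference

variable {L : FirstOrder.Language.{u, v}} (N : TermNorm L)

/-- The initial termination assertion `μ(β) = ⋁_{I ∈ INF(β)} ⋀_{x ∈ I} x` of an abstract binary
clause `β = p(x̄) ← π, p(ȳ)`. -/
def assertionBin (INF : InfProc L) {n : ℕ} (p : L.Relations n) (π : SizeRel (Fin n ⊕ Fin n)) :
    Set (Set (Fin n)) :=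
  {A | ∃ I ∈ INF n p π, ∀ i ∈ I, i ∈ A}

/-- The initial termination assertion `μ(p(x̄)) = ⋀_β μ(β)` of a predicate, where `β` ranges over
the abstract binary clauses `p(x̄) ← π, p(ȳ)`. -/
def assertionPred (INF : InfProc L) (B : SizeBin L) : BoolEnv L :=
  fun n p => {A | ∀ π ∈ B n p n p, A ∈ assertionBin INF p π}

/-- The conditions inferred by termination inference. -/
def inferred (P : Program L) (INF : InfProc L) (B : SizeBin L) : BoolEnv L :=
  backwards N P (assertionPred INF B) (successPatterns N P)

/-- The mode of an argument: bound or free. -/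
inductive ArgMode
  | b
  | f

/-- The mode `p(m̄)` is inferred as terminating: `⋀ {xᵢ | mᵢ = b}` entails the inferred condition
for `p(x̄)`. -/
def IsTerminatingMode (P : Program L) (INF : InfProc L) (B : SizeBin L) {n : ℕ}
    (p : L.Relations n) (m : Fin n → ArgMode) : Prop :=
  {A : Set (Fin n) | ∀ i, m i = ArgMode.b → i ∈ A} ⊆ inferred N P INF B n p

/-- `P` terminates for the mode `p(m̄)`: it terminates for all queries `p(t̄)` in which the bound
arguments are rigid. -/
def TerminatesForMode (P : Program L) {n : ℕ} (p : L.Relations n) (m : Fin n → ArgMode) : Prop :=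
  ∀ t : Fin n → L.Term ℕ, (∀ i, m i = ArgMode.b → N.Rigid (t i)) →
    Terminates P [Lit.atom p t]

end Inference

end LogicProgram

/-! Non-termination yields an infinite chain of calls. `Succeeds` and `Calls` replace resolution by
a semantics that is closed under instantiation: no renaming, no most general unifiers. An infinite
leftmost derivation from an atom yields an infinite `Calls` chain (`accGoal_of_acc_calls`). Reading
"the variable is mapped to a rigid term" as a Boolean model, successes satisfy the success patterns
and every call inherits the inferred precondition (`Calls.satisfies`), hence the assertion of its
predicate. Meanwhile any two members of a chain are described by one abstract binary clause
(`describes_of_chain`). By Dickson's lemma an infinite chain has two calls of one predicate whose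
argument norms weakly increase in every position. The clause describing this pair has a decreasing
set of positions that are rigid in the earlier call, so a non-negative combination of norms strictly
drops, a contradiction. Domination in all positions defeats every choice of coefficients at once, so
no single global ranking is needed. -/

namespace LogicProgram

open FirstOrder.Language

variable {L : FirstOrder.Language.{u, v}}

/-! ### Composition of substitutions -/

section Substitutions

/-- Composition of substitutions: first `θ`, then `σ`. -/
def Subst.comp (θ σ : Subst L) : Subst L := fun x => (θ x).subst σ

theorem term_subst_subst (t : L.Term ℕ) (θ σ : Subst L) :
    (t.subst θ).subst σ = t.subst (θ.comp σ) := by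
  induction t with
  | var x => rfl
  | func f ts ih => simp only [Term.subst, ih]

theorem term_subst_var (t : L.Term ℕ) : t.subst (Term.var : Subst L) = t := by
  induction t with
  | var x => rfl
  | func f ts ih => simp only [Term.subst, ih]

theorem Lit.subst_subst (b : Lit L) (θ σ : Subst L) :
    (b.subst θ).subst σ = b.subst (θ.comp σ) := by
  cases b <;> simp only [Lit.subst, term_subst_subst]

theorem Lit.subst_var (b : Lit L) : b.subst (Term.var : Subst L) = b := by
  cases b <;> simp only [Lit.subst, term_subst_var]

theorem Lit.map_subst_subst (G : List (Lit L)) (θ σ : Subst L) :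
    (G.map (Lit.subst θ)).map (Lit.subst σ) = G.map (Lit.subst (θ.comp σ)) := by
  simp [Lit.subst_subst, Function.comp_def]

theorem Lit.map_subst_var (G : List (Lit L)) :
    G.map (Lit.subst (Term.var : Subst L)) = G := by
  simp [funext Lit.subst_var]

theorem goalVars_mono {G G' : List (Lit L)} (h : G ⊆ G') : goalVars G ⊆ goalVars G' :=
  fun _ ⟨b, hb, hx⟩ => ⟨b, h hb, hx⟩

end Substitutions

/-! ### From leftmost derivations to chains of calls -/

section Operational

/-- `b` is an instance of a literal under one of its computed answers: a fixpoint semantics of the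
program which is closed under instantiation. -/
inductive Succeeds (P : Program L) : Lit L → Prop
  | atom (C : Clause L) (hC : C ∈ P) (θ : Subst L) (h : ∀ b ∈ C.body, Succeeds P (b.subst θ)) :
      Succeeds P (Lit.atom C.pred fun k => (C.head k).subst θ)
  | eq (t : L.Term ℕ) : Succeeds P (Lit.eq t t)

theorem Succeeds.subst {P : Program L} {b : Lit L} (h : Succeeds P b) (σ : Subst L) :
    Succeeds P (b.subst σ) := by
  induction h with
  | atom C hC θ _ ih =>
    simp only [Lit.subst, term_subst_subst]
    exact .atom C hC (θ.comp σ) fun b hb => by simpa only [Lit.subst_subst] using ih b hb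
  | eq t => exact .eq _

/-- `Calls P a b`: after resolving the atom `a` with a clause and answering the literals before
some body atom, that body atom, instantiated to `b`, is called. -/
inductive Calls (P : Program L) : Lit L → Lit L → Prop
  | mk (C : Clause L) (hC : C ∈ P) (u : Fin C.arity → L.Term ℕ) (δ η : Subst L)
      (hu : ∀ k, (u k).subst δ = (C.head k).subst η) (before after : List (Lit L)) {n : ℕ}
      (q : L.Relations n) (s : Fin n → L.Term ℕ)
      (hbody : C.body = before ++ Lit.atom q s :: after)
      (hbefore : ∀ b ∈ before, Succeeds P (b.subst η)) :
      Calls P (Lit.atom C.pred u) (Lit.atom q fun k => (s k).subst η)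

/-- Accessibility of a goal for the converse of the step relation, i.e. termination. -/
abbrev AccGoal (P : Program L) (G : List (Lit L)) : Prop := Acc (fun G' G => Step P G G') G

theorem AccGoal.terminates {P : Program L} {G : List (Lit L)} (h : AccGoal P G) :
    Terminates P G := by
  rintro ⟨g, hg0, hg⟩
  exact not_acc_iff_exists_descending_chain.2 ⟨g, hg0, hg⟩ h

theorem accGoal_nil (P : Program L) : AccGoal P [] :=
  ⟨_, fun _ h => nomatch h⟩

theorem subst_rename_head (C : Clause L) (ρ : Equiv.Perm ℕ) (θ : Subst L) (k : Fin C.arity) :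
    ((C.rename ρ).head k).subst θ = (C.head k).subst ((renameSubst ρ).comp θ) :=
  term_subst_subst _ _ _

theorem map_subst_rename_body (C : Clause L) (ρ : Equiv.Perm ℕ) (θ : Subst L) :
    (C.rename ρ).body.map (Lit.subst θ) = C.body.map (Lit.subst ((renameSubst ρ).comp θ)) :=
  Lit.map_subst_subst _ _ _

/-- A step of a compound goal whose first part is nonempty is a step of the first part, and every
answer of the resulting first part gives an answer of the original one. -/
theorem Step.append_inv {P : Program L} {b : Lit L} {G R H : List (Lit L)}
    (h : Step P (b :: G ++ R) H) :
    ∃ (G' : List (Lit L)) (θ : Subst L), Step P (b :: G) G' ∧ H = G' ++ R.map (Lit.subst θ) ∧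
      ∀ σ, (∀ c ∈ G', Succeeds P (c.subst σ)) →
        ∀ c ∈ b :: G, Succeeds P (c.subst (θ.comp σ)) := by
  generalize hK : b :: G ++ R = K at h
  cases h with
  | resolve C hC ρ s R' θ apart hθ =>
    obtain ⟨rfl, rfl⟩ := List.cons.inj hK
    refine ⟨((C.rename ρ).body ++ G).map (Lit.subst θ), θ, .resolve C hC ρ s G θ ?_ hθ, ?_, ?_⟩
    · refine apart.mono_right (goalVars_mono ?_)
      exact List.cons_subset_cons _ (List.subset_append_left _ _)
    · simp
    · intro σ hσ c hc
      rw [List.map_append, List.forall_mem_append] at hσ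
      rcases List.mem_cons.1 hc with rfl | hc
      · have hu : ∀ k, (s k).subst (θ.comp σ) =
            (C.head k).subst (((renameSubst ρ).comp θ).comp σ) := fun k => by
          rw [← term_subst_subst, hθ.1 _ ⟨k, rfl⟩, subst_rename_head, term_subst_subst]
        simp only [Lit.subst, hu]
        refine .atom C hC _ fun b hb => ?_
        rw [← Lit.subst_subst]
        refine hσ.1 _ ?_
        rw [map_subst_rename_body]
        exact List.mem_map_of_mem hb
      · rw [← Lit.subst_subst]
        exact hσ.2 _ (List.mem_map_of_mem hc)
  | unify s t R' θ hθ =>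
    obtain ⟨rfl, rfl⟩ := List.cons.inj hK
    refine ⟨G.map (Lit.subst θ), θ, .unify s t G θ hθ, by simp, ?_⟩
    intro σ hσ c hc
    rcases List.mem_cons.1 hc with rfl | hc
    · have hu : s.subst (θ.comp σ) = t.subst (θ.comp σ) := by
        rw [← term_subst_subst, ← term_subst_subst, hθ.1 (s, t) rfl]
      simp only [Lit.subst, hu]
      exact .eq _
    · rw [← Lit.subst_subst]
      exact hσ _ (List.mem_map_of_mem hc)

/-- Induction on the accessibility of `G`, with `R` general because each step instantiates it.
Answers of the reduced first part compose with the step's substitution to answers of `G`, so the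
hypothesis on `R` persists. -/
theorem AccGoal.append {P : Program L} {G : List (Lit L)} (hG : AccGoal P G) :
    ∀ R : List (Lit L),
      (∀ θ, (∀ b ∈ G, Succeeds P (b.subst θ)) → AccGoal P (R.map (Lit.subst θ))) →
      AccGoal P (G ++ R) := by
  induction hG with
  | intro G _ ih =>
    intro R hR
    cases G with
    | nil => simpa only [Lit.map_subst_var, List.nil_append] using hR Term.var (by simp)
    | cons b G =>
      refine ⟨_, fun H hH => ?_⟩
      obtain ⟨G', θ, hstep, rfl, hans⟩ := Step.append_inv hH
      refine ih G' hstep _ fun σ hσ => ?_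
      rw [Lit.map_subst_subst]
      exact hR _ (hans σ hσ)

/-- Reduces a body to its single literals. `G` stays uninstantiated while the answers of the
literals already solved accumulate in `θ`. -/
theorem accGoal_map_subst {P : Program L} :
    ∀ (G : List (Lit L)) (θ : Subst L),
      (∀ before b after, G = before ++ b :: after →
        ∀ δ : Subst L, (∀ c ∈ before, Succeeds P (c.subst (θ.comp δ))) →
          AccGoal P [b.subst (θ.comp δ)]) →
      AccGoal P (G.map (Lit.subst θ)) := by
  intro G
  induction G with
  | nil => exact fun _ _ => accGoal_nil P
  | cons b G ih =>
    intro θ h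
    have hb : AccGoal P [b.subst θ] := by
      simpa only [← Lit.subst_subst, Lit.subst_var] using h [] b G rfl Term.var (by simp)
    refine AccGoal.append hb _ fun σ hσ => ?_
    rw [Lit.map_subst_subst]
    refine ih _ fun before c after hG δ hδ => ?_
    have assoc : ∀ d : Lit L, d.subst ((θ.comp σ).comp δ) = d.subst (θ.comp (σ.comp δ)) :=
      fun d => by simp only [← Lit.subst_subst]
    simp only [assoc] at hδ ⊢
    refine h (b :: before) c after (by rw [hG]; rfl) _ ?_
    rw [List.forall_mem_cons]
    refine ⟨?_, hδ⟩
    -- Later answers instantiate `b` further; success survives this.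
    simpa only [← Lit.subst_subst] using (hσ _ (List.mem_singleton_self _)).subst δ

theorem accGoal_eq (P : Program L) (s t : L.Term ℕ) : AccGoal P [Lit.eq s t] := by
  refine ⟨_, fun H hH => ?_⟩
  cases hH
  exact accGoal_nil P

/-- An atom from which there is no infinite chain of calls terminates. -/
theorem accGoal_of_acc_calls {P : Program L} {b : Lit L}
    (h : Acc (fun b' b => Calls P b b') b) : AccGoal P [b] := by
  induction h with
  | intro b _ ih =>
    refine ⟨_, fun H hH => ?_⟩
    generalize hK : [b] = K at hH
    cases hH with
    | resolve C hC ρ s R θ apart hθ =>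
      obtain ⟨rfl, rfl⟩ := List.cons.inj hK
      rw [List.append_nil, map_subst_rename_body]
      refine accGoal_map_subst _ _ fun before c after hbody δ hbefore => ?_
      cases c with
      | eq s t => exact accGoal_eq P _ _
      | atom q t =>
        -- The caller is instantiated by the unifier and then by the answers of the preceding
        -- literals; on the clause side the renaming comes first and is absorbed in the clause
        -- substitution.
        refine ih _ (.mk C hC s (θ.comp δ) _ (fun k => ?_) before after q t hbody hbefore)
        rw [← term_subst_subst, hθ.1 _ ⟨k, rfl⟩, subst_rename_head, term_subst_subst]
    | unify s t R θ hθ =>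
      obtain ⟨rfl, rfl⟩ := List.cons.inj hK
      exact accGoal_nil P

end Operational

/-! ### Rigidity and relevant variables -/

section Norms

variable (N : TermNorm L)

theorem TermNorm.size_subst (w : ℕ → ℕ) (t : L.Term ℕ) (θ : Subst L) :
    N.size w (t.subst θ) = N.size (fun x => N.size w (θ x)) t := by
  induction t with
  | var x => rfl
  | func f ts ih => simp only [Term.subst, TermNorm.size, ih]

theorem TermNorm.norm_subst (t : L.Term ℕ) (θ : Subst L) :
    N.norm (t.subst θ) = N.size (fun x => N.norm (θ x)) t :=
  N.size_subst _ t θ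

theorem TermNorm.size_mono {w w' : ℕ → ℕ} (h : w ≤ w') (t : L.Term ℕ) :
    N.size w t ≤ N.size w' t := by
  induction t with
  | var x => exact h x
  | func f ts ih => exact Nat.add_le_add_left (Finset.sum_le_sum fun i _ => ih i) _

/-- Termwise inequalities sum to an equality only if each is one, so no relevant variable can grow
unnoticed. -/
theorem TermNorm.size_eq_iff {w w' : ℕ → ℕ} (h : w ≤ w') (t : L.Term ℕ) :
    N.size w t = N.size w' t ↔ ∀ x ∈ N.rel t, w x = w' x := by
  induction t with
  | var x => simp [TermNorm.size, TermNorm.rel]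
  | func f ts ih =>
    simp only [TermNorm.size, TermNorm.rel, Nat.add_left_cancel_iff,
      Finset.sum_eq_sum_iff_of_le fun i _ => N.size_mono h (ts i), ih]
    exact ⟨fun H x ⟨i, hi, hx⟩ => H i hi x hx, fun H i hi x hx => H x ⟨i, hi, hx⟩⟩

theorem TermNorm.norm_le_norm_subst (t : L.Term ℕ) (θ : Subst L) :
    N.norm t ≤ N.norm (t.subst θ) := by
  rw [N.norm_subst]
  exact N.size_mono (fun _ => Nat.zero_le _) t

/-- An instance `tθ` is rigid iff `θ` maps all relevant variables of `t` to rigid terms. -/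
theorem TermNorm.rigid_subst_iff (t : L.Term ℕ) (θ : Subst L) :
    N.Rigid (t.subst θ) ↔ N.rel t ⊆ {x | N.Rigid (θ x)} := by
  have key : ∀ σ : Subst L, N.norm ((t.subst θ).subst σ) = N.norm (t.subst θ) ↔
      ∀ x ∈ N.rel t, N.norm ((θ x).subst σ) = N.norm (θ x) := fun σ => by
    -- The weights are the norms of the `θ x` before and after `σ`; they are comparable because
    -- variables have norm `0`, so instantiation never decreases a norm.
    have h := N.size_eq_iff (w := fun x => N.norm (θ x)) (w' := fun x => N.norm ((θ x).subst σ))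
      (fun x => N.norm_le_norm_subst _ _) t
    rw [term_subst_subst, N.norm_subst, N.norm_subst, eq_comm]
    exact h.trans (forall₂_congr fun _ _ => eq_comm)
  exact ⟨fun h x hx σ => (key σ).1 (h σ) x hx, fun h σ => (key σ).2 fun x hx => h hx σ⟩

/-- The rigid arguments of an atom. -/
def rigidArgs {n : ℕ} (u : Fin n → L.Term ℕ) : Set (Fin n) := {k | N.Rigid (u k)}

/-- The variables which a substitution maps to rigid terms. -/
def rigidVars (θ : Subst L) : Set ℕ := {x | N.Rigid (θ x)}

/-- The bridge from Boolean models of clause variables to concrete substitutions. -/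
theorem instArgs_rigidVars {n : ℕ} (s : Fin n → L.Term ℕ) (θ : Subst L) :
    instArgs N s (rigidVars N θ) = rigidArgs N fun k => (s k).subst θ :=
  Set.ext fun k => (N.rigid_subst_iff (s k) θ).symm

end Norms

/-! ### Soundness of abstract answers and success patterns -/

section Success

variable (N : TermNorm L) {P : Program L}

theorem sizeHolds_of_subst {S : SizeAnswers L} {b : Lit L} {θ : Subst L}
    (h : (b.subst θ).SizeHolds N S fun _ => 0) : b.SizeHolds N S fun x => N.norm (θ x) := by
  cases b <;> simpa only [Lit.subst, Lit.SizeHolds, N.size_subst, TermNorm.norm] using h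

theorem Succeeds.sizeHolds {S : SizeAnswers L} {B : SizeBin L} (hB : IsSizeAnalysis N P S B)
    {b : Lit L} (h : Succeeds P b) : b.SizeHolds N S fun _ => 0 := by
  induction h with
  | atom C hC θ _ ih =>
    simpa only [Lit.SizeHolds, N.size_subst, TermNorm.norm] using
      hB.answer C hC _ fun b hb => sizeHolds_of_subst N (ih b hb)
  | eq t => rfl

/-- The success of a literal, as a property of its rigid arguments. -/
def RigidSuccess (Ψ : BoolEnv L) : Lit L → Prop
  | .atom (n := n) p u => rigidArgs N u ∈ Ψ n p
  | .eq s t => N.Rigid s ↔ N.Rigid t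

theorem rigidVars_mem_success_iff {Ψ : BoolEnv L} {b : Lit L} {θ : Subst L} :
    rigidVars N θ ∈ b.success N Ψ ↔ RigidSuccess N Ψ (b.subst θ) := by
  cases b with
  | atom p s =>
    simp only [Lit.success, Set.mem_ofPred_eq, instArgs_rigidVars]
    rfl
  | eq s t => exact iff_congr (N.rigid_subst_iff s θ).symm (N.rigid_subst_iff t θ).symm

theorem Succeeds.rigidSuccess {b : Lit L} (h : Succeeds P b) :
    RigidSuccess N (successPatterns N P) b := by
  induction h with
  | atom C hC θ _ ih =>
    show _ ∈ successPatterns N P C.arity C.pred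
    -- Unfolds the fixed point once; the clause substitution supplies the model.
    rw [successPatterns, ← OrderHom.map_lfp]
    exact ⟨C.head, C.body, hC, rigidVars N θ, instArgs_rigidVars N _ _,
      fun b hb => (rigidVars_mem_success_iff N).2 (ih b hb)⟩
  | eq t => exact Iff.rfl

end Success

/-! ### Soundness of backwards analysis -/

section Preconditions

variable (N : TermNorm L) {P : Program L}

/-- Rounding into `Pos` only strengthens a condition, which is the safe direction for projection and
pseudo-complement. -/
theorem posPart_subset {V : Type} (f : Set (Set V)) : posPart f ⊆ f :=
  Set.sUnion_subset fun _ hσ => hσ.2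

/-- An atom satisfies a precondition if all its instances have their rigid arguments among the
models. -/
def Satisfies (Φ : BoolEnv L) : Lit L → Prop
  | .atom (n := n) p u => ∀ σ : Subst L, (rigidArgs N fun k => (u k).subst σ) ∈ Φ n p
  | .eq _ _ => True

/-- Modus ponens along the body: the pseudo-complement entails implication, and each successful
predecessor discharges its premise. -/
theorem rigidVars_mem_pre_of_bodyCond {Φ : BoolEnv L} {θ : Subst L} {b : Lit L}
    {after : List (Lit L)} : ∀ {before : List (Lit L)},
      rigidVars N θ ∈ bodyCond N (successPatterns N P) Φ (before ++ b :: after) →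
      (∀ c ∈ before, Succeeds P (c.subst θ)) → rigidVars N θ ∈ b.pre N Φ
  | [], h, _ => h.1
  | c :: _, h, hs => by
    refine rigidVars_mem_pre_of_bodyCond (posPart_subset _ h.2 ?_)
      fun d hd => hs d (List.mem_cons_of_mem c hd)
    exact (rigidVars_mem_success_iff N).2 ((hs c List.mem_cons_self).rigidSuccess N)

theorem mem_clauseCond_of_mem_backwards {μ Ψ : BoolEnv L} {C : Clause L} (hC : C ∈ P)
    {A : Set (Fin C.arity)} (hA : A ∈ backwards N P μ Ψ C.arity C.pred) :
    A ∈ clauseCond N μ Ψ (backwards N P μ Ψ) C.pred C.head C.body := by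
  rw [backwards, ← OrderHom.map_gfp] at hA
  exact hA.2 C.head C.body hC

/-- The inferred preconditions are inherited by all calls. -/
theorem Calls.satisfies {μ : BoolEnv L} {a b : Lit L} (h : Calls P a b)
    (ha : Satisfies N (backwards N P μ (successPatterns N P)) a) :
    Satisfies N (backwards N P μ (successPatterns N P)) b := by
  obtain ⟨C, hC, u, δ, η, hu, before, after, q, s, hbody, hbefore⟩ := h
  intro σ
  -- The call sees the caller instantiated by `δ`, and then by `σ`; this is why `Satisfies` ranges
  -- over all instances.
  have hcond := (posPart_subset _ (mem_clauseCond_of_mem_backwards N hC (ha (δ.comp σ)))).2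
    (rigidVars N (η.comp σ)) (by
      rw [instArgs_rigidVars]
      simp only [← term_subst_subst, hu])
  rw [hbody] at hcond
  have hpre := rigidVars_mem_pre_of_bodyCond N hcond fun c hc => by
    simpa only [Lit.subst_subst] using (hbefore c hc).subst σ
  simpa only [Lit.pre, Set.mem_ofPred_eq, instArgs_rigidVars, term_subst_subst] using hpre

/-- Assertions enter the fixed point only through clauses, so a clause for the predicate is
required. -/
theorem Satisfies.assertion {μ : BoolEnv L} {C : Clause L} (hC : C ∈ P)
    {u : Fin C.arity → L.Term ℕ}
    (h : Satisfies N (backwards N P μ (successPatterns N P)) (Lit.atom C.pred u)) :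
    rigidArgs N u ∈ μ C.arity C.pred := by
  have h' := h Term.var
  simp only [term_subst_var] at h'
  exact (posPart_subset _ (mem_clauseCond_of_mem_backwards N hC h')).1

end Preconditions

/-! ### Size descriptions of call chains and the contradiction -/

section Chains

variable (N : TermNorm L) {P : Program L} {S : SizeAnswers L} {B : SizeBin L}

/-- The abstract binary clauses in `B` describe the pair of an instance of `a` and `b`. -/
def Describes (B : SizeBin L) : Lit L → Lit L → Prop
  | .atom (n := m) p u, .atom (n := n) q v => ∃ δ : Subst L, ∃ π ∈ B m p n q,
      SizeRel.Holds π (Sum.elim (fun k => N.norm ((u k).subst δ)) fun k => N.norm (v k))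
  | _, _ => True

theorem Calls.describes (hB : IsSizeAnalysis N P S B) {a b : Lit L} (h : Calls P a b) :
    Describes N B a b := by
  obtain ⟨C, hC, u, δ, η, hu, before, after, q, s, hbody, hbefore⟩ := h
  refine ⟨δ, ?_⟩
  simp only [hu, N.norm_subst]
  exact hB.call C hC _ before after _ q s hbody
    fun b hb => sizeHolds_of_subst N ((hbefore b hb).sizeHolds N hB)

/-- The description of `b` and `c` speaks of an instance of `b`. Its substitution is pushed back
into the clause of the first call, whose earlier literals still succeed, so that `comp` applies. -/
theorem Calls.describes_trans (hB : IsSizeAnalysis N P S B) {a b c : Lit L} (h : Calls P a b)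
    (hbc : Describes N B b c) : Describes N B a c := by
  obtain ⟨C, hC, u, δ, η, hu, before, after, q, s, hbody, hbefore⟩ := h
  cases c with
  | eq s t => trivial
  | atom r v =>
    obtain ⟨δ', π', hπ', hholds⟩ := hbc
    refine ⟨δ.comp δ', ?_⟩
    simp only [term_subst_subst, N.norm_subst _ (η.comp δ')] at hholds
    simp only [← term_subst_subst, hu]
    simp only [term_subst_subst, N.norm_subst _ (η.comp δ')]
    refine hB.comp C hC _ before after _ q s hbody (fun b hb => ?_) _ r _ π' hπ' hholds
    refine sizeHolds_of_subst N (Succeeds.sizeHolds N hB ?_)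
    simpa only [Lit.subst_subst] using (hbefore b hb).subst δ'

theorem describes_of_chain (hB : IsSizeAnalysis N P S B) {c : ℕ → Lit L}
    (hc : ∀ i, Calls P (c i) (c (i + 1))) {i j : ℕ} (hij : i < j) :
    Describes N B (c i) (c j) := by
  obtain ⟨d, rfl⟩ := Nat.exists_eq_add_of_lt hij
  clear hij
  induction d generalizing i with
  | zero => exact (hc i).describes N hB
  | succ d ih =>
    refine (hc i).describes_trans N hB ?_
    convert ih (i := i + 1) using 2
    omega

/-- If the size of every argument of a later call of the same predicate is at least the size in
the earlier call, then the abstract binary clause describing both has no set of arguments which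
is decreasing and rigid in the earlier call. -/
theorem not_describes_of_le {INF : InfProc L} (hINF : INF.Sound) {n : ℕ} {p : L.Relations n}
    {u v : Fin n → L.Term ℕ} (hu : rigidArgs N u ∈ assertionPred INF B n p)
    (huv : ∀ k, N.norm (u k) ≤ N.norm (v k)) :
    ¬ Describes N B (Lit.atom p u) (Lit.atom p v) := by
  rintro ⟨δ, π, hπ, hholds⟩
  obtain ⟨I, hI, hrigid⟩ := hu π hπ
  obtain ⟨a, ha, hdec⟩ := hINF n p π I hI
  refine (hdec _ _ hholds).not_ge (Finset.sum_le_sum fun i hi => ?_)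
  refine mul_le_mul_of_nonneg_left ?_ (ha i)
  -- The description concerns an instance of `u`; at rigid positions its norms are those of `u`.
  rw [hrigid i hi δ]
  exact_mod_cast huv i

theorem Calls.exists_clause {a b : Lit L} (h : Calls P a b) :
    ∃ C : {C : Clause L // C ∈ P}, ∃ u, a = Lit.atom C.1.pred u := by
  obtain ⟨C, hC, u, _⟩ := h
  exact ⟨⟨C, hC⟩, u, rfl⟩

/-- In an infinite chain of calls the sizes of some call dominate, by Dickson's lemma, those of an
earlier call of the same predicate. -/
theorem exists_norm_le_of_chain {c : ℕ → Lit L} (hc : ∀ i, Calls P (c i) (c (i + 1))) :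
    ∃ C ∈ P, ∃ i j, i < j ∧ ∃ u v : Fin C.arity → L.Term ℕ, c i = Lit.atom C.pred u ∧
      c j = Lit.atom C.pred v ∧ ∀ k, N.norm (u k) ≤ N.norm (v k) := by
  choose D u hu using fun i => (hc i).exists_clause
  have : Finite {C : Clause L // C ∈ P} := List.finite_toSet P
  -- Pigeonhole over the finitely many clauses, each of which fixes a predicate, leaves an infinite
  -- subsequence in a single `ℕ^n`.
  obtain ⟨C, hC⟩ := Finite.exists_infinite_fiber D
  classical
  let f : ℕ ↪o ℕ := Nat.orderEmbeddingOfSet (D ⁻¹' {C})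
  have hf : ∀ i, ∃ v : Fin C.1.arity → L.Term ℕ, c (f i) = Lit.atom C.1.pred v := fun i => by
    have hi : f i ∈ D ⁻¹' {C} :=
      (Nat.orderEmbeddingOfSet_range (D ⁻¹' {C})).subset (Set.mem_range_self i)
    rw [← Set.mem_singleton_iff.1 hi]
    exact ⟨_, hu _⟩
  choose v hv using hf
  obtain ⟨i, j, hij, hle⟩ :=
    wellQuasiOrdered_le (fun i k => N.norm (v i k) : ℕ → Fin C.1.arity → ℕ)
  exact ⟨C.1, C.2, f i, f j, f.strictMono hij, v i, v j, hv i, hv j, hle⟩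

theorem acc_calls_of_satisfies (hB : IsSizeAnalysis N P S B) {INF : InfProc L}
    (hINF : INF.Sound) {a : Lit L} (ha : Satisfies N (inferred N P INF B) a) :
    Acc (fun b' b => Calls P b b') a := by
  by_contra hacc
  obtain ⟨c, rfl, hc⟩ := not_acc_iff_exists_descending_chain.1 hacc
  have hsat : ∀ i, Satisfies N (inferred N P INF B) (c i) := fun i => by
    induction i with
    | zero => exact ha
    | succ i ih => exact (hc i).satisfies N ih
  obtain ⟨C, hC, i, j, hij, u, v, hu, hv, hle⟩ := exists_norm_le_of_chain N hc
  have hi := hsat i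
  have hdesc := describes_of_chain N hB hc hij
  rw [hu] at hi hdesc
  rw [hv] at hdesc
  exact not_describes_of_le N hINF (Satisfies.assertion N hC hi) hle hdesc

end Chains

theorem TermNorm.Rigid.subst {N : TermNorm L} {t : L.Term ℕ} (h : N.Rigid t) (σ : Subst L) :
    N.Rigid (t.subst σ) := fun θ => by
  rw [term_subst_subst, h, h]

end LogicProgram

theorem theorem2 {L : FirstOrder.Language.{u, v}} (N : LogicProgram.TermNorm L)
    (P : LogicProgram.Program L)
    (S : LogicProgram.SizeAnswers L) (B : LogicProgram.SizeBin L)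
    (hB : LogicProgram.IsSizeAnalysis N P S B)
    (INF : LogicProgram.InfProc L) (hINF : INF.Sound)
    {n : ℕ} (p : L.Relations n) (m : Fin n → LogicProgram.ArgMode)
    (hm : LogicProgram.IsTerminatingMode N P INF B p m) :
    LogicProgram.TerminatesForMode N P p m := by
  intro t ht
  -- Rigid arguments stay rigid under instantiation, so the mode condition covers every instance of
  -- the query.
  have hsat : LogicProgram.Satisfies N (LogicProgram.inferred N P INF B)
      (LogicProgram.Lit.atom p t) := fun σ => hm fun i hi => (ht i hi).subst σ
  exact (LogicProgram.accGoal_of_acc_calls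
    (LogicProgram.acc_calls_of_satisfies N hB hINF hsat)).terminates
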